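/- \textbf{Timed automata.} Let $Act$ be a finite set of actions. A timed automaton over a finite set $C$ of clocks is $A=(L,l_0,E,I)$ with $L$ a finite set of locations, $l_0\in L$, $E$ a finite set of edges $l\xrightarrow{g,a,r}l'$ ($g$ a clock constraint, $a\in Act$, $r\subseteq C$) and $I$ a map from $L$ to clock constraints; clock constraints are given by $g::=x\smile c\mid g\wedge g$ with $x\in C$, $c\in\mathbb N$, $\smile\,\in\{\le,<,=,>,\ge\}$. Its timed labelled transition system $T(A)$ has as states (processes) the pairs $(l,v)$, $v:C\to\mathbb R_{\ge0}$, $v\models I(l)$; $(l,v)\xrightarrow{a}(l',v[r])$ if there is an edge $l\xrightarrow{g,a,r}l'$ with $v\models g$ and $v[r]\models I(l')$, where $v[r]$ sets the clocks in $r$ to $0$; and $(l,v)\xrightarrow{d}(l,v+d)$ for $d\in\mathbb R_{\ge0}$ if $v\models I(l)$ and $v+d\models I(l)$. \textbf{Bisimilarities.} A symmetric relation $R$ on the states of a timed labelled transition system is a \emph{time abstracted bisimulation} if $p_1\,R\,p_2$ implies: for every $p_1\xrightarrow{a}p_1'$ with $a\in Act$ there is $p_2\xrightarrow{a}p_2'$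 with $p_1'\,R\,p_2'$, and for every $p_1\xrightarrow{d}p_1'$ with $d\in\mathbb R_{\ge0}$ there are $d'\in\mathbb R_{\ge0}$ and $p_2\xrightarrow{d'}p_2'$ with $p_1'\,R\,p_2'$. It is a \emph{time abstracted delay bisimulation} if the same holds with the first clause replaced by: for every $p_1\xrightarrow{a}p_1'$ there are $d\in\mathbb R_{\ge0}$ and $p_2\xrightarrow{d}\xrightarrow{a}p_2'$ with $p_1'\,R\,p_2'$. Time abstracted bisimilarity $\sim_u$ and time abstracted delay bisimilarity $\sim_y$ are the largest such relations. Processes of two automata are compared in the disjoint union of the two transition systems. \textbf{Zone valuation graphs.} Let $Lep=Act\cup\{\varepsilon\}$. A zone is a finite union of sets of valuations, each defined by finitely many constraints $x\smile c$ or $x-y\smile c$ ($c\in\mathbb N$). A \emph{zone valuation graph} of a process $p$ of $A$ is a graph with an initial node, with edges labelled in $Lep$, and with a finite set $S$ of nodes, each node $s$ consisting of a set of locations and a convex zone, such that the following hold. Say that a process lies in $s$ if its location and its valuation belong to these two sets, and let $\mathcal G(s)$ be the set of processes reachable from $p$ that lie in $s$. (1) $p$ lies in the initial node. (2) Any two processes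 of $T(A)$ that lie in the same node are time abstracted bisimilar. (3) Every process reachable from $p$ lies in some node. (4) $s\xrightarrow{a}s'$, for $a\in Act$, iff some process of $\mathcal G(s)$ has an $a$-transition to a process of $\mathcal G(s')$; and $\xrightarrow{\varepsilon}$ is the transitive closure of the relation ``some process of $\mathcal G(s)$ has a delay transition (of some length $d\ge0$) to a process of $\mathcal G(s')$''. (5) Every node is reachable from the initial node. (Minimality of the number of nodes is not required.) \textbf{Game.} For such graphs $Z_1,Z_2$, the game $\Gamma^{Z,\langle a,\varepsilon\to a\rangle}_\infty$ ($a\in Lep$) starts at the pair of initial nodes and has infinitely many rounds. In each round the attacker chooses one of the two graphs (it may change the graph from round to round without restriction), some $a\in Lep$ and an edge labelled $a$ from the current node of that graph; the defender must answer in the other graph with a path $\xrightarrow{\varepsilon}\xrightarrow{a}$ from its current node. The end points are the new current nodes. The defender loses if at some round it has no answer, and otherwise wins. \textbf{Lemma (Time Abstracted Delay Bisimulation Game).} Let $A_1,A_2$ be timed automata over $Act$ (with possibly different clocks), let $p$ be a process of $T(A_1)$ and $q$ a process of $T(A_2)$, and let $Z_1,Z_2$ be zone valuation graphs of $p$ and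 of $q$. Then the defender has a winning strategy in the game $\Gamma^{Z,\langle a,\varepsilon\to a\rangle}_\infty$ on $Z_1,Z_2$ if and only if $p\sim_y q$. -/

import Mathlib

open scoped NNReal

/-! ## Timed automata -/

/-- The comparison symbols `≤, <, =, >, ≥`. -/
inductive Cmp
  | le | lt | eq | gt | ge

/-- `r ⌣ s` for real numbers. -/
def Cmp.holds : Cmp → ℝ → ℝ → Prop
  | .le, r, s => r ≤ s
  | .lt, r, s => r < s
  | .eq, r, s => r = s
  | .gt, r, s => r > s
  | .ge, r, s => r ≥ s

/-- Clock valuations `C → ℝ≥0`. -/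
abbrev ClockValuation (C : Type*) := C → ℝ≥0

/-- Clock constraints `g ::= x ⌣ c | g ∧ g`, with `c` a natural number. -/
inductive ClockConstraint (C : Type*)
  | atom (x : C) (r : Cmp) (c : ℕ)
  | conj (g h : ClockConstraint C)

/-- `v ⊨ g`. -/
def ClockConstraint.sat {C : Type*} (v : ClockValuation C) : ClockConstraint C → Prop
  | .atom x r c => r.holds (v x) c
  | .conj g h => g.sat v ∧ h.sat v

/-- An edge `l --g,a,r--> l'` of a timed automaton. -/
structure Edge (L C Act : Type*) where
  source : L
  guard : ClockConstraint C
  action : Act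
  reset : Set C
  target : L

/-- A timed automaton `(L, l₀, E, I)` over the clocks `C` and the actions `Act`. Finiteness of
`L`, `C` and `Act` is imposed by type class arguments where automata are used. -/
structure TimedAutomaton (L C Act : Type*) where
  init : L
  edges : Set (Edge L C Act)
  edges_finite : edges.Finite
  inv : L → ClockConstraint C

open Classical in
/-- `v[r]`: the clocks in `r` are set to `0`. -/
noncomputable def ClockValuation.reset {C : Type*} (v : ClockValuation C) (r : Set C) : ClockValuation C :=
  fun x => if x ∈ r then 0 else v x

/-- `v + d`: every clock is incremented by `d`. -/
def ClockValuation.shift {C : Type*} (v : ClockValuation C) (d : ℝ≥0) : ClockValuation C :=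
  fun x => v x + d

/-- A timed labelled transition system with states `P`: transitions labelled by actions and
transitions labelled by delays. -/
structure TLTS (P Act : Type*) where
  act : P → Act → P → Prop
  delay : P → ℝ≥0 → P → Prop

/-- The disjoint union of two timed labelled transition systems; it is used to compare states of
two different systems. -/
def TLTS.sum {P Q Act : Type*} (S : TLTS P Act) (T : TLTS Q Act) : TLTS (P ⊕ Q) Act where
  act
    | .inl p, a, .inl p' => S.act p a p'
    | .inr q, a, .inr q' => T.act q a q'
    | _, _, _ => False
  delay
    | .inl p, d, .inl p' => S.delay p d p'
    | .inr q, d, .inr q' => T.delay q d q'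
    | _, _, _ => False

/-- `p'` can be reached from `p` by finitely many action and delay transitions. -/
def TLTS.Reachable {P Act : Type*} (T : TLTS P Act) : P → P → Prop :=
  Relation.ReflTransGen fun p p' => (∃ a, T.act p a p') ∨ ∃ d, T.delay p d p'

namespace TimedAutomaton

variable {L C Act : Type*}

/-- Processes (states): pairs `(l, v)` with `v ⊨ I(l)`. -/
def Proc (A : TimedAutomaton L C Act) : Type _ :=
  {s : L × ClockValuation C // (A.inv s.1).sat s.2}

/-- The location of a process. -/
def Proc.loc {A : TimedAutomaton L C Act} (p : A.Proc) : L := p.1.1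

/-- The clock valuation of a process. -/
def Proc.val {A : TimedAutomaton L C Act} (p : A.Proc) : ClockValuation C := p.1.2

/-- The timed labelled transition system `T(A)` generated by `A`. (The invariants of source and
target are part of the type of processes.) -/
def tlts (A : TimedAutomaton L C Act) : TLTS A.Proc Act where
  act p a p' := ∃ e ∈ A.edges, e.source = p.loc ∧ e.action = a ∧ e.target = p'.loc ∧
    e.guard.sat p.val ∧ p'.val = p.val.reset e.reset
  delay p d p' := p'.loc = p.loc ∧ p'.val = p.val.shift d

end TimedAutomaton

/-! ## Time abstracted bisimilarity and time abstracted delay bisimilarity -/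

/-- `R` is a time abstracted bisimulation relation on the states of `T`. -/
def TLTS.IsTimeAbstractedBisimulation {P Act : Type*} (T : TLTS P Act) (R : P → P → Prop) :
    Prop :=
  (∀ p q, R p q → R q p) ∧
  ∀ p q, R p q →
    (∀ a p', T.act p a p' → ∃ q', T.act q a q' ∧ R p' q') ∧
    (∀ d p', T.delay p d p' → ∃ d' q', T.delay q d' q' ∧ R p' q')

/-- Time abstracted bisimilarity `∼_u`, the largest time abstracted bisimulation relation. -/
def TLTS.TimeAbstractedBisimilar {P Act : Type*} (T : TLTS P Act) (p q : P) : Prop :=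
  ∃ R, T.IsTimeAbstractedBisimulation R ∧ R p q

/-- `R` is a time abstracted delay bisimulation relation on the states of `T`: an action `a` is
answered by some delay followed by `a`, and a delay is answered by some delay. -/
def TLTS.IsTimeAbstractedDelayBisimulation {P Act : Type*} (T : TLTS P Act)
    (R : P → P → Prop) : Prop :=
  (∀ p q, R p q → R q p) ∧
  ∀ p q, R p q →
    (∀ a p', T.act p a p' → ∃ d r q', T.delay q d r ∧ T.act r a q' ∧ R p' q') ∧
    (∀ d p', T.delay p d p' → ∃ d' q', T.delay q d' q' ∧ R p' q')

/-- Time abstracted delay bisimilarity `∼_y`, the largest time abstracted delay bisimulation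
relation. -/
def TLTS.TimeAbstractedDelayBisimilar {P Act : Type*} (T : TLTS P Act) (p q : P) : Prop :=
  ∃ R, T.IsTimeAbstractedDelayBisimulation R ∧ R p q

/-! ## Zone valuation graphs -/

/-- Atomic zone constraints: clock constraints `x ⌣ c` and diagonal constraints `x - y ⌣ c`. -/
inductive ZoneAtom (C : Type*)
  | clock (x : C) (r : Cmp) (c : ℕ)
  | diag (x y : C) (r : Cmp) (c : ℕ)

/-- Satisfaction of an atomic zone constraint; the difference is taken in `ℝ`. -/
def ZoneAtom.sat {C : Type*} (v : ClockValuation C) : ZoneAtom C → Prop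
  | .clock x r c => r.holds (v x) c
  | .diag x y r c => r.holds ((v x : ℝ) - (v y : ℝ)) c

/-- A zone is a finite union of characteristic sets of linear formulas, a linear formula being a
finite conjunction of clock constraints and diagonal constraints. -/
def IsZone {C : Type*} (W : Set (ClockValuation C)) : Prop :=
  ∃ F : List (List (ZoneAtom C)), W = {v | ∃ φ ∈ F, ∀ a ∈ φ, a.sat v}

/-- The set `Lep = Act ∪ {ε}`. -/
inductive Lep (Act : Type*)
  | eps
  | act (a : Act)

/-- A node of a zone graph. It has a set of locations, because nodes that belong to different
locations may be merged; a node with one location has a singleton here. -/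
structure ZoneNode (L C : Type*) where
  locs : Set L
  zone : Set (ClockValuation C)

/-- A zone graph `(S, s₀, Lep, →)`. -/
structure ZoneGraph (L C Act : Type*) where
  nodes : Set (ZoneNode L C)
  init : ZoneNode L C
  trans : ZoneNode L C → Lep Act → ZoneNode L C → Prop

section

variable {L C Act : Type*} {A : TimedAutomaton L C Act}

/-- The process `p` lies in the node `s`. -/
def TimedAutomaton.Proc.Mem (p : A.Proc) (s : ZoneNode L C) : Prop :=
  p.loc ∈ s.locs ∧ p.val ∈ s.zone

/-- `𝒢(s)`: the processes in the node `s` that are reachable from `p`. -/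
def ZoneNode.processes (s : ZoneNode L C) (p : A.Proc) : Set A.Proc :=
  {p' | A.tlts.Reachable p p' ∧ p'.Mem s}

/-- Some process of `𝒢(s)` has an `a`-transition to a process of `𝒢(s')`. -/
def ActStep (p : A.Proc) (s : ZoneNode L C) (a : Act) (s' : ZoneNode L C) : Prop :=
  ∃ r ∈ s.processes p, ∃ r' ∈ s'.processes p, A.tlts.act r a r'

/-- Some process of `𝒢(s)` has a delay transition to a process of `𝒢(s')`. -/
def DelayStep (p : A.Proc) (s s' : ZoneNode L C) : Prop :=
  ∃ r ∈ s.processes p, ∃ r' ∈ s'.processes p, ∃ d, A.tlts.delay r d r'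

/-- `Z` is a zone valuation graph of the process `p` of `A`. The transitions of `Z` are those
induced by the transitions of the processes in the nodes, the `ε`-transitions being closed under
transitivity (they are reflexive by delays of length `0`). No minimality of the number of nodes
is required, so that the canonical minimal graph is one of the graphs described here. -/
structure IsZoneValuationGraph (p : A.Proc) (Z : ZoneGraph L C Act) : Prop where
  nodes_finite : Z.nodes.Finite
  zone : ∀ s ∈ Z.nodes, IsZone s.zone
  convex : ∀ s ∈ Z.nodes, Convex ℝ≥0 s.zone
  init_mem : Z.init ∈ Z.nodes
  mem_init : p.Mem Z.init
  /-- two processes of `T(A)` in the same node are time abstracted bisimilar -/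
  bisimilar : ∀ s ∈ Z.nodes, ∀ r r' : A.Proc, r.Mem s → r'.Mem s →
    A.tlts.TimeAbstractedBisimilar r r'
  /-- every process that is reachable from `p` lies in a node -/
  cover : ∀ r : A.Proc, A.tlts.Reachable p r → ∃ s ∈ Z.nodes, r.Mem s
  trans_act : ∀ s a s', Z.trans s (.act a) s' ↔
    s ∈ Z.nodes ∧ s' ∈ Z.nodes ∧ ActStep p s a s'
  trans_eps : ∀ s s', Z.trans s .eps s' ↔
    Relation.TransGen (fun t t' => t ∈ Z.nodes ∧ t' ∈ Z.nodes ∧ DelayStep p t t') s s'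
  /-- the graph is connected: every node is reachable from the initial node -/
  connected : ∀ s ∈ Z.nodes, Relation.ReflTransGen (fun t t' => ∃ α, Z.trans t α t') Z.init s

end

/-! ## Games -/

/-- There is a path from `s` to `s'` in `Z` labelled by the given word over `Lep`. -/
def ZoneGraph.Path {L C Act : Type*} (Z : ZoneGraph L C Act) :
    ZoneNode L C → List (Lep Act) → ZoneNode L C → Prop
  | s, [], s' => s = s'
  | s, α :: w, s' => ∃ t, Z.trans s α t ∧ Z.Path t w s'

/-- What the attacker does in a round: it chooses one of the two graphs, a label `α` and a target
node in the chosen graph. -/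
inductive Challenge (N₁ N₂ Act : Type*)
  | left (α : Lep Act) (t₁ : N₁)
  | right (α : Lep Act) (t₂ : N₂)

/-- A game that is played on the graphs `Z₁` and `Z₂`, with infinitely many rounds, no restriction
on alternations and no extra condition. For the label `α`, the attacker moves along the word
`att α` in the graph of its choice, and the defender answers along `dfn α` in the other graph. -/
structure BisimulationGame (L₁ C₁ L₂ C₂ Act : Type*) where
  Z₁ : ZoneGraph L₁ C₁ Act
  Z₂ : ZoneGraph L₂ C₂ Act
  att : Lep Act → List (Lep Act)
  dfn : Lep Act → List (Lep Act)

namespace BisimulationGame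

variable {L₁ C₁ L₂ C₂ Act : Type*}

/-- Positions: the current nodes in the two graphs. -/
abbrev Position (_G : BisimulationGame L₁ C₁ L₂ C₂ Act) := ZoneNode L₁ C₁ × ZoneNode L₂ C₂

/-- The attacker's moves. -/
abbrev Move (_G : BisimulationGame L₁ C₁ L₂ C₂ Act) :=
  Challenge (ZoneNode L₁ C₁) (ZoneNode L₂ C₂) Act

/-- The challenge is a legal move of the attacker in the given position. -/
def LegalChallenge (G : BisimulationGame L₁ C₁ L₂ C₂ Act) (s : G.Position) : G.Move → Prop
  | .left α t₁ => G.Z₁.Path s.1 (G.att α) t₁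
  | .right α t₂ => G.Z₂.Path s.2 (G.att α) t₂

/-- The new position `t` results from a legal answer of the defender to the challenge. -/
def LegalResponse (G : BisimulationGame L₁ C₁ L₂ C₂ Act) (s : G.Position) :
    G.Move → G.Position → Prop
  | .left α t₁, t => t.1 = t₁ ∧ G.Z₂.Path s.2 (G.dfn α) t.2
  | .right α t₂, t => t.2 = t₂ ∧ G.Z₁.Path s.1 (G.dfn α) t.1

/-- A strategy of the defender: given the history (the earlier positions and challenges, latest
first), the current position and the current challenge, it chooses the next position. -/
abbrev Strategy (G : BisimulationGame L₁ C₁ L₂ C₂ Act) :=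
  List (G.Position × G.Move) → G.Position → G.Move → G.Position

/-- `G.Play σ h s`: there is a play from the initial nodes with finitely many rounds, with history
`h` and current position `s`, in which the defender follows `σ` and all moves are legal. -/
inductive Play (G : BisimulationGame L₁ C₁ L₂ C₂ Act) (σ : G.Strategy) :
    List (G.Position × G.Move) → G.Position → Prop
  | start : Play G σ [] (G.Z₁.init, G.Z₂.init)
  | round (h : List (G.Position × G.Move)) (s : G.Position) (c : G.Move) :
      Play G σ h s → G.LegalChallenge s c → G.LegalResponse s c (σ h s c) →
      Play G σ ((s, c) :: h) (σ h s c)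

/-- The defender has a winning strategy: following it, the defender can answer every challenge in
every round of every play. -/
def DefenderWins (G : BisimulationGame L₁ C₁ L₂ C₂ Act) : Prop :=
  ∃ σ : G.Strategy, ∀ h s c, G.Play σ h s → G.LegalChallenge s c →
    G.LegalResponse s c (σ h s c)

end BisimulationGame

/-- The game `Γ^{Z, ⟨a, ε → a⟩}_∞`, `a ∈ Lep`, on the graphs `Z₁` and `Z₂`. -/
def delayGame {L₁ C₁ L₂ C₂ Act : Type*} (Z₁ : ZoneGraph L₁ C₁ Act) (Z₂ : ZoneGraph L₂ C₂ Act) :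
    BisimulationGame L₁ C₁ L₂ C₂ Act where
  Z₁ := Z₁
  Z₂ := Z₂
  att α := [α]
  dfn α := [.eps, α]

/-! Each graph and its process simulate each other label by label, so the game and the delay
bisimulation can be translated into each other. An edge of the graph is witnessed by one process of
the source node. Any other process there is bisimilar to the witness and so can match its
transition, but its successor need not lie in the target node; it is only bisimilar to a process
there. Hence processes and nodes are linked by `ZoneNode.Represents`, which is closed under
bisimilarity, rather than by membership. With this link, `exists_trans` lifts process steps to edges
and `exists_step` realises edges by process steps.

It remains to give both sides the same shape. Zero delays and additivity of delays put the delay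
bisimulation clauses into the form "`ε`, then `α`" for every label, and a winning strategy amounts
to an invariant on positions (`defenderWins_iff`). -/

/-- Transitions labelled by `Lep`: the label `ε` stands for a delay of arbitrary length. -/
def TLTS.Step {P Act : Type*} (T : TLTS P Act) (x : P) : Lep Act → P → Prop
  | .eps, x' => ∃ d, T.delay x d x'
  | .act a, x' => T.act x a x'

/-- Delays of length zero exist, and consecutive delays compose. -/
structure TLTS.DelayClosed {P Act : Type*} (T : TLTS P Act) : Prop where
  refl : ∀ x, T.Step x .eps x
  trans : ∀ x y z, T.Step x .eps y → T.Step y .eps z → T.Step x .eps z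

/-! ### Bisimilarities on abstract systems with composable delays. -/

namespace TLTS

variable {P Q Act : Type*} {T : TLTS P Act}

theorem Reachable.step {p x x' : P} {α : Lep Act} (h : T.Reachable p x) (hs : T.Step x α x') :
    T.Reachable p x' := by
  refine Relation.ReflTransGen.tail h ?_
  cases α with
  | eps => exact .inr hs
  | act a => exact .inl ⟨a, hs⟩

theorem TimeAbstractedBisimilar.symm {x y : P} (h : T.TimeAbstractedBisimilar x y) :
    T.TimeAbstractedBisimilar y x := by
  obtain ⟨R, hR, hxy⟩ := h
  exact ⟨R, hR, hR.1 _ _ hxy⟩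

theorem TimeAbstractedBisimilar.step {x y x' : P} {α : Lep Act}
    (h : T.TimeAbstractedBisimilar x y) (hs : T.Step x α x') :
    ∃ y', T.Step y α y' ∧ T.TimeAbstractedBisimilar x' y' := by
  obtain ⟨R, hR, hxy⟩ := h
  cases α with
  | eps =>
    obtain ⟨d, hd⟩ := hs
    obtain ⟨d', y', hy, hr⟩ := (hR.2 _ _ hxy).2 d x' hd
    exact ⟨y', ⟨d', hy⟩, R, hR, hr⟩
  | act a =>
    obtain ⟨y', hy, hr⟩ := (hR.2 _ _ hxy).1 a x' hs
    exact ⟨y', hy, R, hR, hr⟩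

/-- The composite of `∼_u` with itself is again a time abstracted bisimulation. -/
theorem TimeAbstractedBisimilar.trans {x y z : P} (hxy : T.TimeAbstractedBisimilar x y)
    (hyz : T.TimeAbstractedBisimilar y z) : T.TimeAbstractedBisimilar x z := by
  refine ⟨fun x z => ∃ y, T.TimeAbstractedBisimilar x y ∧ T.TimeAbstractedBisimilar y z,
    ⟨fun x z ⟨y, h₁, h₂⟩ => ⟨y, h₂.symm, h₁.symm⟩, fun x z ⟨y, h₁, h₂⟩ => ⟨?_, ?_⟩⟩, y, hxy, hyz⟩
  · intro a x' hx
    obtain ⟨y', hy, h₁'⟩ := h₁.step (α := .act a) hx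
    obtain ⟨z', hz, h₂'⟩ := h₂.step hy
    exact ⟨z', hz, y', h₁', h₂'⟩
  · intro d x' hx
    obtain ⟨y', hy, h₁'⟩ := h₁.step (α := .eps) ⟨d, hx⟩
    obtain ⟨z', ⟨d', hz⟩, h₂'⟩ := h₂.step hy
    exact ⟨d', z', hz, y', h₁', h₂'⟩

/-- On transition systems with composable delays, a symmetric relation is a time abstracted delay
bisimulation as soon as every transition is matched by an `ε`-transition followed by a transition
with the same label. -/
theorem DelayClosed.isTimeAbstractedDelayBisimulation_iff (hT : T.DelayClosed)
    {R : P → P → Prop} :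
    T.IsTimeAbstractedDelayBisimulation R ↔ (∀ x y, R x y → R y x) ∧
      ∀ x y, R x y → ∀ α x', T.Step x α x' →
        ∃ z y', T.Step y .eps z ∧ T.Step z α y' ∧ R x' y' := by
  refine and_congr_right fun _ => forall₂_congr fun x y => imp_congr_right fun _ => ⟨?_, ?_⟩
  · rintro ⟨ha, hd⟩ (_ | a) x' hx
    · obtain ⟨d, hx⟩ := hx
      obtain ⟨d', y', hy, h⟩ := hd d x' hx
      -- The extra `ε` is a delay of length zero.
      exact ⟨y, y', hT.refl y, ⟨d', hy⟩, h⟩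
    · obtain ⟨d, z, y', hz, hy, h⟩ := ha a x' hx
      exact ⟨z, y', ⟨d, hz⟩, hy, h⟩
  · refine fun h => ⟨fun a x' hx => ?_, fun d x' hx => ?_⟩
    · obtain ⟨z, y', ⟨d, hz⟩, hy, h'⟩ := h (.act a) x' hx
      exact ⟨d, z, y', hz, hy, h'⟩
    · obtain ⟨z, y', hz, hy, h'⟩ := h .eps x' ⟨d, hx⟩
      -- For `α = ε` the answer consists of two delays, which merge into one.
      obtain ⟨d', hy'⟩ := hT.trans _ _ _ hz hy
      exact ⟨d', y', hy', h'⟩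

variable {S : TLTS Q Act}

theorem step_inl_iff {x : P} {α : Lep Act} {u : P ⊕ Q} :
    (T.sum S).Step (.inl x) α u ↔ ∃ x', u = .inl x' ∧ T.Step x α x' := by
  cases α <;> cases u <;> simp [Step, TLTS.sum]

theorem step_inr_iff {y : Q} {α : Lep Act} {u : P ⊕ Q} :
    (T.sum S).Step (.inr y) α u ↔ ∃ y', u = .inr y' ∧ S.Step y α y' := by
  cases α <;> cases u <;> simp [Step, TLTS.sum]

theorem DelayClosed.sum (hT : T.DelayClosed) (hS : S.DelayClosed) : (T.sum S).DelayClosed where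
  refl
    | .inl x => step_inl_iff.2 ⟨x, rfl, hT.refl x⟩
    | .inr y => step_inr_iff.2 ⟨y, rfl, hS.refl y⟩
  trans
    | .inl x, u, v, h₁, h₂ => by
      obtain ⟨x', rfl, h₁⟩ := step_inl_iff.1 h₁
      obtain ⟨x'', rfl, h₂⟩ := step_inl_iff.1 h₂
      exact step_inl_iff.2 ⟨x'', rfl, hT.trans _ _ _ h₁ h₂⟩
    | .inr y, u, v, h₁, h₂ => by
      obtain ⟨y', rfl, h₁⟩ := step_inr_iff.1 h₁
      obtain ⟨y'', rfl, h₂⟩ := step_inr_iff.1 h₂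
      exact step_inr_iff.2 ⟨y'', rfl, hS.trans _ _ _ h₁ h₂⟩

/-- Delay bisimilarity of states of two systems, by means of a relation between the two. -/
theorem timeAbstractedDelayBisimilar_inl_inr_iff (hT : T.DelayClosed) (hS : S.DelayClosed)
    {p : P} {q : Q} :
    (T.sum S).TimeAbstractedDelayBisimilar (.inl p) (.inr q) ↔
      ∃ R : P → Q → Prop, R p q ∧ ∀ x y, R x y →
        (∀ α x', T.Step x α x' → ∃ z y', S.Step y .eps z ∧ S.Step z α y' ∧ R x' y') ∧
        (∀ α y', S.Step y α y' → ∃ z x', T.Step x .eps z ∧ T.Step z α x' ∧ R x' y') := by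
  simp only [TimeAbstractedDelayBisimilar, (hT.sum hS).isTimeAbstractedDelayBisimulation_iff]
  constructor
  · rintro ⟨R, ⟨hsymm, hR⟩, hpq⟩
    refine ⟨fun x y => R (.inl x) (.inr y), hpq, fun x y hxy => ⟨fun α x' hx => ?_,
      fun α y' hy => ?_⟩⟩
    · obtain ⟨z, u, hz, hu, h⟩ := hR _ _ hxy α (.inl x') (step_inl_iff.2 ⟨x', rfl, hx⟩)
      obtain ⟨z, rfl, hz⟩ := step_inr_iff.1 hz
      obtain ⟨y', rfl, hu'⟩ := step_inr_iff.1 hu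
      exact ⟨z, y', hz, hu', h⟩
    · obtain ⟨z, u, hz, hu, h⟩ :=
        hR _ _ (hsymm _ _ hxy) α (.inr y') (step_inr_iff.2 ⟨y', rfl, hy⟩)
      obtain ⟨z, rfl, hz⟩ := step_inl_iff.1 hz
      obtain ⟨x', rfl, hu'⟩ := step_inl_iff.1 hu
      exact ⟨z, x', hz, hu', hsymm _ _ h⟩
  · rintro ⟨R, hpq, hR⟩
    -- `R` together with its converse, since a bisimulation on the disjoint union has to be
    -- symmetric.
    refine ⟨fun u v => (∃ x y, u = .inl x ∧ v = .inr y ∧ R x y) ∨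
      ∃ x y, u = .inr y ∧ v = .inl x ∧ R x y, ⟨?_, ?_⟩, .inl ⟨p, q, rfl, rfl, hpq⟩⟩
    · rintro u v (⟨x, y, rfl, rfl, h⟩ | ⟨x, y, rfl, rfl, h⟩)
      · exact .inr ⟨x, y, rfl, rfl, h⟩
      · exact .inl ⟨x, y, rfl, rfl, h⟩
    · rintro u v (⟨x, y, rfl, rfl, h⟩ | ⟨x, y, rfl, rfl, h⟩) α u' hu
      · obtain ⟨x', rfl, hu'⟩ := step_inl_iff.1 hu
        obtain ⟨z, y', hz, hy, h'⟩ := (hR x y h).1 α x' hu'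
        exact ⟨.inr z, .inr y', step_inr_iff.2 ⟨z, rfl, hz⟩, step_inr_iff.2 ⟨y', rfl, hy⟩,
          .inl ⟨x', y', rfl, rfl, h'⟩⟩
      · obtain ⟨y', rfl, hu'⟩ := step_inr_iff.1 hu
        obtain ⟨z, x', hz, hx, h'⟩ := (hR x y h).2 α y' hu'
        exact ⟨.inl z, .inl x', step_inl_iff.2 ⟨z, rfl, hz⟩, step_inl_iff.2 ⟨x', rfl, hx⟩,
          .inr ⟨x', y', rfl, rfl, h'⟩⟩

end TLTS

theorem TimedAutomaton.tlts_delayClosed {L C Act : Type*} (A : TimedAutomaton L C Act) :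
    A.tlts.DelayClosed where
  refl x := ⟨0, rfl, by funext c; simp [ClockValuation.shift]⟩
  trans x y z := by
    rintro ⟨d, hl, hv⟩ ⟨d', hl', hv'⟩
    refine ⟨d + d', hl'.trans hl, ?_⟩
    rw [hv', hv]
    funext c
    simp [ClockValuation.shift, add_assoc]

/-! ### Processes and zone valuation graphs simulate each other. -/

section

variable {L C Act : Type*} {A : TimedAutomaton L C Act}

/-- The process `x` is time abstracted bisimilar to some process of `𝒢(s)`. -/
def ZoneNode.Represents (p : A.Proc) (s : ZoneNode L C) (x : A.Proc) : Prop :=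
  ∃ u ∈ s.processes p, A.tlts.TimeAbstractedBisimilar x u

variable {p : A.Proc} {Z : ZoneGraph L C Act}

namespace IsZoneValuationGraph

theorem represents_init (hZ : IsZoneValuationGraph p Z) : Z.init.Represents p p :=
  ⟨p, ⟨.refl, hZ.mem_init⟩, hZ.bisimilar _ hZ.init_mem _ _ hZ.mem_init hZ.mem_init⟩

theorem target_mem (hZ : IsZoneValuationGraph p Z) {s s' : ZoneNode L C} {α : Lep Act}
    (h : Z.trans s α s') : s' ∈ Z.nodes := by
  cases α with
  | eps =>
    rcases (hZ.trans_eps s s').1 h with h | ⟨_, h⟩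
    · exact h.2.1
    · exact h.2.1
  | act a => exact ((hZ.trans_act s a s').1 h).2.1

/-- Transitions of processes are simulated by the graph. -/
theorem exists_trans (hZ : IsZoneValuationGraph p Z) {s : ZoneNode L C} (hs : s ∈ Z.nodes)
    {x x' : A.Proc} {α : Lep Act} (h : s.Represents p x) (hx : A.tlts.Step x α x') :
    ∃ s', Z.trans s α s' ∧ s'.Represents p x' := by
  obtain ⟨u, hu, hxu⟩ := h
  obtain ⟨u', hstep, hxu'⟩ := hxu.step hx
  have hreach := hu.1.step hstep
  obtain ⟨s', hs', hmem⟩ := hZ.cover u' hreach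
  refine ⟨s', ?_, u', ⟨hreach, hmem⟩, hxu'⟩
  cases α with
  | eps =>
    obtain ⟨d, hd⟩ := hstep
    exact (hZ.trans_eps s s').2 (.single ⟨hs, hs', u, hu, u', ⟨hreach, hmem⟩, d, hd⟩)
  | act a => exact (hZ.trans_act s a s').2 ⟨hs, hs', u, hu, u', ⟨hreach, hmem⟩, hstep⟩

/-- All processes of a node are bisimilar, so `x` is bisimilar to the witness `r` of the edge and
can copy its step; `r'` then represents the result. -/
theorem exists_step_of_processes (hZ : IsZoneValuationGraph p Z) {s s' : ZoneNode L C}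
    (hs : s ∈ Z.nodes) {x r r' : A.Proc} {α : Lep Act} (h : s.Represents p x)
    (hr : r ∈ s.processes p) (hr' : r' ∈ s'.processes p) (hstep : A.tlts.Step r α r') :
    ∃ x', A.tlts.Step x α x' ∧ s'.Represents p x' := by
  obtain ⟨u, hu, hxu⟩ := h
  obtain ⟨x', hx', h'⟩ := (hxu.trans (hZ.bisimilar s hs u r hu.2 hr.2)).symm.step hstep
  exact ⟨x', hx', r', hr', h'.symm⟩

/-- Transitions of the graph are simulated by the processes. -/
theorem exists_step (hZ : IsZoneValuationGraph p Z) {s s' : ZoneNode L C} {x : A.Proc}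
    {α : Lep Act} (h : s.Represents p x) (ht : Z.trans s α s') :
    ∃ x', A.tlts.Step x α x' ∧ s'.Represents p x' := by
  cases α with
  | act a =>
    obtain ⟨hs, -, r, hr, r', hr', hstep⟩ := (hZ.trans_act s a s').1 ht
    exact hZ.exists_step_of_processes hs h hr hr' hstep
  | eps =>
    rw [hZ.trans_eps] at ht
    -- Consecutive links of the chain may have unrelated witnesses in the node they share;
    -- representation bridges them, and the resulting delays add up.
    induction ht with
    | single hst =>
      obtain ⟨hs, -, r, hr, r', hr', hstep⟩ := hst
      exact hZ.exists_step_of_processes hs h hr hr' hstep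
    | tail _ hst ih =>
      obtain ⟨y, hy, hrep⟩ := ih
      obtain ⟨hs, -, r, hr, r', hr', hstep⟩ := hst
      obtain ⟨x', hx', h'⟩ := hZ.exists_step_of_processes (α := .eps) hs hrep hr hr' hstep
      exact ⟨x', A.tlts_delayClosed.trans _ _ _ hy hx', h'⟩

end IsZoneValuationGraph

theorem ZoneGraph.path_singleton_iff {s s' : ZoneNode L C} {α : Lep Act} :
    Z.Path s [α] s' ↔ Z.trans s α s' := by
  simp [ZoneGraph.Path]

theorem ZoneGraph.path_pair_iff {s s' : ZoneNode L C} {α β : Lep Act} :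
    Z.Path s [α, β] s' ↔ ∃ t, Z.trans s α t ∧ Z.trans t β s' := by
  simp [ZoneGraph.Path]

end

/-! ### Strategies and invariants, and the main equivalence. -/

/-- Winning for the defender, by means of an invariant on positions. -/
theorem BisimulationGame.defenderWins_iff {L₁ C₁ L₂ C₂ Act : Type*}
    (G : BisimulationGame L₁ C₁ L₂ C₂ Act) :
    G.DefenderWins ↔ ∃ W : G.Position → Prop, W (G.Z₁.init, G.Z₂.init) ∧
      ∀ s c, W s → G.LegalChallenge s c → ∃ t, G.LegalResponse s c t ∧ W t := by
  classical
  constructor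
  · rintro ⟨σ, hσ⟩
    -- The invariant: positions that occur in some play following `σ`.
    refine ⟨fun s => ∃ h, G.Play σ h s, ⟨[], .start⟩, ?_⟩
    rintro s c ⟨h, hp⟩ hc
    exact ⟨σ h s c, hσ h s c hp hc, _, .round h s c hp hc (hσ h s c hp hc)⟩
  · rintro ⟨W, h₀, hW⟩
    -- A positional strategy suffices; its values outside `W` or at illegal challenges are
    -- irrelevant.
    choose! f hf using hW
    refine ⟨fun _ s c => f s c, ?_⟩
    have key : ∀ h s, G.Play (fun _ s c => f s c) h s → W s := by
      intro h s hp
      induction hp with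
      | start => exact h₀
      | round h s c _ hc _ ih => exact (hf s c ih hc).2
    exact fun h s c hp hc => (hf s c (key h s hp) hc).1

theorem mainTheorem7 {L₁ C₁ L₂ C₂ Act : Type*}
    [Finite L₁] [Finite C₁] [Finite L₂] [Finite C₂] [Finite Act]
    (A₁ : TimedAutomaton L₁ C₁ Act) (A₂ : TimedAutomaton L₂ C₂ Act)
    (p : A₁.Proc) (q : A₂.Proc)
    (Z₁ : ZoneGraph L₁ C₁ Act) (Z₂ : ZoneGraph L₂ C₂ Act)
    (hZ₁ : IsZoneValuationGraph p Z₁) (hZ₂ : IsZoneValuationGraph q Z₂) :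
    (delayGame Z₁ Z₂).DefenderWins ↔
      (A₁.tlts.sum A₂.tlts).TimeAbstractedDelayBisimilar (.inl p) (.inr q) := by
  rw [BisimulationGame.defenderWins_iff,
    TLTS.timeAbstractedDelayBisimilar_inl_inr_iff A₁.tlts_delayClosed A₂.tlts_delayClosed]
  constructor
  · rintro ⟨W, h₀, hW⟩
    -- Two processes are related when they are represented by the two nodes of a position in the
    -- invariant.
    refine ⟨fun x y => ∃ s₁ ∈ Z₁.nodes, ∃ s₂ ∈ Z₂.nodes,
      W (s₁, s₂) ∧ s₁.Represents p x ∧ s₂.Represents q y,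
      ⟨_, hZ₁.init_mem, _, hZ₂.init_mem, h₀, hZ₁.represents_init, hZ₂.represents_init⟩, ?_⟩
    rintro x y ⟨s₁, hs₁, s₂, hs₂, hs, hx, hy⟩
    refine ⟨fun α x' hstep => ?_, fun α y' hstep => ?_⟩
    · obtain ⟨t₁, ht₁, hx'⟩ := hZ₁.exists_trans hs₁ hx hstep
      obtain ⟨⟨t₁', t₂⟩, ⟨rfl, hpath⟩, ht⟩ :=
        hW _ (.left α t₁) hs (ZoneGraph.path_singleton_iff.2 ht₁)
      obtain ⟨t, hst, htt⟩ := ZoneGraph.path_pair_iff.1 hpath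
      obtain ⟨z, hz, hzt⟩ := hZ₂.exists_step hy hst
      obtain ⟨y', hy', hyt⟩ := hZ₂.exists_step hzt htt
      exact ⟨z, y', hz, hy', _, hZ₁.target_mem ht₁, _, hZ₂.target_mem htt, ht, hx', hyt⟩
    · obtain ⟨t₂, ht₂, hy'⟩ := hZ₂.exists_trans hs₂ hy hstep
      obtain ⟨⟨t₁, t₂'⟩, ⟨rfl, hpath⟩, ht⟩ :=
        hW _ (.right α t₂) hs (ZoneGraph.path_singleton_iff.2 ht₂)
      obtain ⟨t, hst, htt⟩ := ZoneGraph.path_pair_iff.1 hpath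
      obtain ⟨z, hz, hzt⟩ := hZ₁.exists_step hx hst
      obtain ⟨x', hx', hxt⟩ := hZ₁.exists_step hzt htt
      exact ⟨z, x', hz, hx', _, hZ₁.target_mem htt, _, hZ₂.target_mem ht₂, ht, hxt, hy'⟩
  · rintro ⟨R, hpq, hR⟩
    -- Conversely, a position is good when its nodes represent some `R`-related pair.
    refine ⟨fun s => s.1 ∈ Z₁.nodes ∧ s.2 ∈ Z₂.nodes ∧
      ∃ x y, R x y ∧ s.1.Represents p x ∧ s.2.Represents q y,
      ⟨hZ₁.init_mem, hZ₂.init_mem, p, q, hpq, hZ₁.represents_init, hZ₂.represents_init⟩, ?_⟩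
    rintro ⟨s₁, s₂⟩ (⟨α, t₁⟩ | ⟨α, t₂⟩) ⟨hs₁, hs₂, x, y, hxy, hx, hy⟩ hc
    · have ht₁ : Z₁.trans s₁ α t₁ := ZoneGraph.path_singleton_iff.1 hc
      obtain ⟨x', hstep, hx'⟩ := hZ₁.exists_step hx ht₁
      obtain ⟨z, y', hz, hy', hxy'⟩ := (hR x y hxy).1 α x' hstep
      obtain ⟨t, hst, hzt⟩ := hZ₂.exists_trans hs₂ hy hz
      obtain ⟨t₂, htt, hyt⟩ := hZ₂.exists_trans (hZ₂.target_mem hst) hzt hy'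
      exact ⟨(t₁, t₂), ⟨rfl, ZoneGraph.path_pair_iff.2 ⟨t, hst, htt⟩⟩,
        hZ₁.target_mem ht₁, hZ₂.target_mem htt, x', y', hxy', hx', hyt⟩
    · have ht₂ : Z₂.trans s₂ α t₂ := ZoneGraph.path_singleton_iff.1 hc
      obtain ⟨y', hstep, hy'⟩ := hZ₂.exists_step hy ht₂
      obtain ⟨z, x', hz, hx', hxy'⟩ := (hR x y hxy).2 α y' hstep
      obtain ⟨t, hst, hzt⟩ := hZ₁.exists_trans hs₁ hx hz
      obtain ⟨t₁, htt, hxt⟩ := hZ₁.exists_trans (hZ₁.target_mem hst) hzt hx'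
      exact ⟨(t₁, t₂), ⟨rfl, ZoneGraph.path_pair_iff.2 ⟨t, hst, htt⟩⟩,
        hZ₁.target_mem htt, hZ₂.target_mem ht₂, x', y', hxy', hxt, hy'⟩
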